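/- Let $L|K$ be a finite cyclic field extension (i.e. $L|K$ is finite Galois with cyclic Galois group) of degree $n$. For an abelian group $D$ (written additively), a *unitary $D$-grading* of $L$ over $K$ is a direct sum decomposition $L=\bigoplus_{d\in D}L_d$ into $K$-subspaces with $L_dL_e\subseteq L_{d+e}$ for all $d,e\in D$, $L_0=K$, and $L_d\cap L^\times\neq\emptyset$ for every $d\in D$. For a subgroup $D'\subseteq D$ put $L_{D'}=\bigoplus_{d\in D'}L_d$. The grading is called *co-Galois* if every intermediate field $K\subseteq E\subseteq L$ is of the form $E=L_{D'}$ for some subgroup $D'\subseteq D$ and, in case $\operatorname{char}K=\ell>0$, the $\ell$-primary component of $D$ is trivial. Write $\mu_m(F)=\{x\in F^\times : x^m=1\}$ for a field $F$, let $\operatorname{red}(n)$ be the product of the distinct prime factors of $n$, and let $\operatorname{ered}(n)=\operatorname{red}(n)$ if $4\nmid n$ and $\operatorname{ered}(n)=2\operatorname{red}(n)$ if $4\mid n$. Then $L$ has a unitary grading over $K$ (by some abelian group $D$) if and only if $$|\mu_n(L)|=n\quad\text{and}\quad |\mu_{\operatorname{ered}(n)}(K)|=\operatorname{ered}(n).$$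 Moreover, every unitary grading of $L$ over $K$ is a co-Galois grading. -/

import Mathlib

/-- A family `𝒜 : D → Submodule A B` is a unitary `D`-grading of the `A`-algebra `B` if
`B` is the direct sum of the `𝒜 d`, `1 ∈ 𝒜 0`, `𝒜 d * 𝒜 e ⊆ 𝒜 (d + e)`, the structure map
identifies `A` with `𝒜 0`, and every `𝒜 d` contains a unit of `B`. -/
structure IsUnitaryGrading {A B D : Type*} [CommRing A] [CommRing B] [Algebra A B]
    [AddCommGroup D] (𝒜 : D → Submodule A B) : Prop where
  gradedMonoid : SetLike.GradedMonoid 𝒜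
  isInternal : letI := Classical.decEq D; DirectSum.IsInternal 𝒜
  algebraMap_injective : Function.Injective (algebraMap A B)
  zero_eq : 𝒜 0 = LinearMap.range (Algebra.linearMap A B)
  exists_unit : ∀ d : D, ∃ x ∈ 𝒜 d, IsUnit x

/-- The graded part `B_{D'} = ∑_{d ∈ D'} B_d` attached to a subgroup `D'` of `D`. -/
def gradedPart {A B D : Type*} [CommRing A] [CommRing B] [Algebra A B]
    [AddCommGroup D] (𝒜 : D → Submodule A B) (D' : AddSubgroup D) : Submodule A B :=
  ⨆ d ∈ D', 𝒜 d

/-- A unitary `D`-grading of a field extension `L|K` is co-Galois if `D` has no nontrivial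
`ℓ`-primary torsion when `char K = ℓ > 0`, and every intermediate field is of the form
`L_{D'}` for a subgroup `D'` of `D`. -/
structure IsCoGaloisGrading {K L D : Type*} [Field K] [Field L] [Algebra K L]
    [AddCommGroup D] (𝒜 : D → Submodule K L) : Prop where
  isUnitaryGrading : IsUnitaryGrading 𝒜
  torsion_eq_zero : ∀ ℓ : ℕ, 0 < ℓ → CharP K ℓ →
    ∀ (k : ℕ) (d : D), ℓ ^ k • d = 0 → d = 0
  intermediateField_graded : ∀ E : IntermediateField K L,
    ∃ D' : AddSubgroup D, Subalgebra.toSubmodule E.toSubalgebra = gradedPart 𝒜 D'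

/-- The reduction of `n`: the product of the (distinct) prime factors of `n`. -/
noncomputable def red (n : ℕ) : ℕ := UniqueFactorizationMonoid.radical n

/-- The extended reduction of `n`: it is `red n` if `4 ∤ n` and `2 * red n` if `4 ∣ n`. -/
noncomputable def ered (n : ℕ) : ℕ := if 4 ∣ n then 2 * red n else red n

/-! Let `σ` generate the Galois group, and let `S j = 1 + k + ⋯ + k ^ (j - 1)`. If `σ ζ = ζ ^ k` and
`σ x = ζ * x`, then `(σ ^ j) x = ζ ^ S j * x`. In a unitary grading each component is a line, and
subgroups of `D` give intermediate fields of degree their order. A cyclic extension has at most one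
of each degree, so `D` is cyclic of order `n`; counting then gives the co-Galois property, and a
homogeneous generator `x` of `L` has `x ^ n` in `K`. For `ζ = σ x / x` the conjugates of `x` are
distinct, so `ζ` has order `n` and `S` permutes the residues mod `n`. This forces `ered n ∣ k - 1`,
i.e. `σ` fixes `ζ ^ (n / ered n)`. Conversely, `ered n ∣ k - 1` gives `n ∣ S j ↔ n ∣ j`; a Lagrange
resolvent supplies `x`, only the identity fixes it, and its powers grade `L`. -/

/-! ### Arithmetic of geometric sums modulo `n` -/

open Finset in
/-- Divisibility by `ered n` in terms of primes. -/
theorem ered_dvd_iff {n : ℕ} (hn : n ≠ 0) {m : ℕ} :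
    ered n ∣ m ↔ (∀ p, p.Prime → p ∣ n → p ∣ m) ∧ (4 ∣ n → 4 ∣ m) := by
  have hred : ∀ m, red n ∣ m ↔ ∀ p, p.Prime → p ∣ n → p ∣ m := by
    intro m
    rw [red, Nat.radical_eq_prod_primeFactors]
    constructor
    · intro h p hp hpn
      exact (dvd_prod_of_mem _ (Nat.mem_primeFactors.2 ⟨hp, hpn, hn⟩)).trans h
    · intro h
      refine prod_primes_dvd _ (fun p hp => (Nat.prime_of_mem_primeFactors hp).prime) fun p hp => ?_
      exact h p (Nat.prime_of_mem_primeFactors hp) (Nat.dvd_of_mem_primeFactors hp)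
  unfold ered
  split_ifs with h4
  · have h2 : 2 ∈ n.primeFactors :=
      Nat.mem_primeFactors.2 ⟨Nat.prime_two, (by norm_num : 2 ∣ 4).trans h4, hn⟩
    have he : 2 * red n = 4 * ∏ p ∈ n.primeFactors.erase 2, p := by
      rw [red, Nat.radical_eq_prod_primeFactors, ← mul_prod_erase _ _ h2]
      ring
    constructor
    · intro h
      refine ⟨(hred m).1 ((dvd_mul_left _ _).trans h), fun _ => ?_⟩
      exact (he ▸ dvd_mul_right _ _ : 4 ∣ 2 * red n).trans h
    · rintro ⟨h, h'⟩
      rw [he]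
      refine Nat.Coprime.mul_dvd_of_dvd_of_dvd ?_ (h' h4) ?_
      · refine Nat.Coprime.prod_right fun p hp => ?_
        obtain ⟨hp2, hp⟩ := mem_erase.1 hp
        rw [show 4 = 2 ^ 2 by norm_num]
        exact Nat.Coprime.pow_left _
          ((Nat.coprime_primes Nat.prime_two (Nat.prime_of_mem_primeFactors hp)).2 hp2.symm)
      · refine (prod_dvd_prod_of_subset _ _ _ (erase_subset _ _)).trans ?_
        rw [← Nat.radical_eq_prod_primeFactors]
        exact (hred m).2 h
  · simp [hred, h4]

theorem ered_dvd_self {n : ℕ} (hn : n ≠ 0) : ered n ∣ n :=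
  (ered_dvd_iff hn).2 ⟨fun _ _ h => h, fun h => h⟩

/-- Lifting the exponent for `1 + k + ⋯ + k ^ (j - 1)`. -/
theorem emultiplicity_geom_sum {p : ℕ} (hp : p.Prime) {k : ℤ} (hk : (p : ℤ) ∣ k - 1)
    (h4 : p = 2 → 4 ∣ k - 1) (j : ℕ) :
    emultiplicity (p : ℤ) (∑ i ∈ Finset.range j, k ^ i) = emultiplicity (p : ℤ) j := by
  -- For `k = 1` the multiplicity of `k - 1` is infinite and could not be cancelled below.
  obtain rfl | hk1 := eq_or_ne k 1
  · simp
  have hpk : ¬ (p : ℤ) ∣ k := fun h => by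
    have := dvd_sub h hk
    rw [sub_sub_cancel] at this
    exact hp.one_lt.ne' (by exact_mod_cast Int.eq_one_of_dvd_one (by positivity) this)
  have key : emultiplicity (p : ℤ) (k ^ j - 1) =
      emultiplicity (p : ℤ) (k - 1) + emultiplicity (p : ℤ) (j : ℤ) := by
    obtain rfl | hp2 := eq_or_ne p 2
    · simpa using Int.two_pow_sub_pow' (x := k) (y := 1) j (h4 rfl) (by simpa using hpk)
    · have := Int.emultiplicity_pow_sub_pow hp (hp.odd_of_ne_two hp2) (x := k) (y := 1) hk hpk j
      rwa [one_pow, ← Int.natCast_emultiplicity p j] at this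
  rw [← geom_sum_mul, mul_comm, emultiplicity_mul (Nat.prime_iff_prime_int.1 hp)] at key
  refine ENat.add_right_injective_of_ne_top ?_ key
  rw [Ne, emultiplicity_eq_top, not_not]
  exact Int.finiteMultiplicity_iff.2 ⟨by simpa using hp.one_lt.ne', sub_ne_zero.2 hk1⟩

theorem dvd_geom_sum_iff_of_ered_dvd {n : ℕ} (hn : n ≠ 0) {k : ℕ} (hk : 1 ≤ k)
    (h : ered n ∣ k - 1) (j : ℕ) :
    n ∣ ∑ i ∈ Finset.range j, k ^ i ↔ n ∣ j := by
  obtain ⟨hp, h4⟩ := (ered_dvd_iff hn).1 h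
  have hcast : ∀ d : ℕ, d ∣ k - 1 → (d : ℤ) ∣ (k : ℤ) - 1 := fun d hd => by
    have := Int.natCast_dvd_natCast.2 hd
    rwa [Nat.cast_sub hk, Nat.cast_one] at this
  have key : ∀ p a : ℕ, p.Prime → p ^ a ∣ n →
      (p ^ a ∣ ∑ i ∈ Finset.range j, k ^ i ↔ p ^ a ∣ j) := by
    intro p a pp hpa
    obtain rfl | ha := eq_or_ne a 0
    · simp
    have hpk := hcast p (hp p pp ((dvd_pow_self p ha).trans hpa))
    rw [← Int.natCast_dvd_natCast, ← Int.natCast_dvd_natCast (n := j)]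
    push_cast
    by_cases hc : p = 2 → 4 ∣ n
    · rw [pow_dvd_iff_le_emultiplicity, pow_dvd_iff_le_emultiplicity,
        emultiplicity_geom_sum pp hpk (fun h => by exact_mod_cast hcast 4 (h4 (hc h)))]
    -- Lifting the exponent may fail at `2` when `4 ∤ n`, but then only parity matters.
    · push Not at hc
      obtain ⟨rfl, hc⟩ := hc
      have ha1 : a = 1 := by
        by_contra ha1
        exact hc ((pow_dvd_pow 2 (by omega : 2 ≤ a)).trans hpa)
      subst ha1
      rw [pow_one]
      refine (dvd_iff_dvd_of_dvd_sub ?_)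
      have : ((∑ i ∈ Finset.range j, (k : ℤ) ^ i) - j) =
          ∑ i ∈ Finset.range j, ((k : ℤ) ^ i - 1) := by simp
      rw [this]
      exact Finset.dvd_sum fun i _ => hpk.trans (sub_one_dvd_pow_sub_one _ _)
  rw [Nat.dvd_iff_prime_pow_dvd_dvd, Nat.dvd_iff_prime_pow_dvd_dvd]
  exact forall_congr' fun p => forall_congr' fun a => forall_congr' fun pp =>
    forall_congr' fun hpa => key p a pp hpa

/-- The sums have period `r` mod `q`, so take at most `r` values there; yet they hit every residue
mod `n`, hence mod `q`. -/
theorem le_of_dvd_geom_sum {n k q r : ℕ} (hn : n ≠ 0) (hq : q ∣ n) (hr : 0 < r)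
    (hinj : Set.InjOn (fun j => (∑ i ∈ Finset.range j, k ^ i) % n) (Finset.range n))
    (h : q ∣ ∑ i ∈ Finset.range r, k ^ i) : q ≤ r := by
  set S : ℕ → ℕ := fun j => ∑ i ∈ Finset.range j, k ^ i with hS
  have hper : ∀ j, S (j + r) ≡ S j [MOD q] := by
    intro j
    have hrec : S (j + r) = S j + k ^ j * S r := by
      simp only [hS, Finset.sum_range_add, Finset.mul_sum, pow_add]
    rw [hrec]
    simpa using (Nat.ModEq.refl (S j)).add ((Nat.modEq_zero_iff_dvd.2 h).mul_left (k ^ j))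
  have hmod : ∀ j, S j ≡ S (j % r) [MOD q] := by
    intro j
    induction j using Nat.strong_induction_on with
    | _ j ih =>
      obtain hj | hj := lt_or_ge j r
      · rw [Nat.mod_eq_of_lt hj]
      · have h1 := hper (j - r)
        rw [Nat.sub_add_cancel hj] at h1
        rw [Nat.mod_eq_sub_mod hj]
        exact h1.trans (ih _ (by omega))
  have hnpos := Nat.pos_of_ne_zero hn
  have hsurj : Set.SurjOn (fun j => S j % n) (Finset.range n) (Finset.range n) :=
    Finset.surjOn_of_injOn_of_card_le _
      (fun j _ => by simpa using Nat.mod_lt _ hnpos) hinj le_rfl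
  have hqpos := Nat.pos_of_dvd_of_pos hq hnpos
  have : Finset.range q ⊆ (Finset.range r).image (fun j => S j % q) := by
    intro y hy
    rw [Finset.mem_range] at hy
    obtain ⟨j, -, hj⟩ := hsurj (a := y) (by
      simpa using hy.trans_le (Nat.le_of_dvd hnpos hq))
    refine Finset.mem_image.2 ⟨j % r, by simpa using Nat.mod_lt _ hr, ?_⟩
    have h1 : S j % q = y := by
      rw [← Nat.mod_mod_of_dvd _ hq]
      simp only at hj
      rw [hj, Nat.mod_eq_of_lt hy]
    rw [← h1]
    exact (hmod j).symm
  simpa using (Finset.card_le_card this).trans Finset.card_image_le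

/-- A prime `p ∣ n` with `p ∤ k - 1` would divide the sum of length `p - 1` by Fermat; if `k ≡ 3`
mod `4`, then `4` divides `1 + k`. Both sums are too short. -/
theorem ered_dvd_of_injOn_geom_sum {n k : ℕ} (hn : n ≠ 0) (hk : 1 ≤ k) (hkn : k.Coprime n)
    (hinj : Set.InjOn (fun j => (∑ i ∈ Finset.range j, k ^ i) % n) (Finset.range n)) :
    ered n ∣ k - 1 := by
  refine (ered_dvd_iff hn).2 ⟨fun p pp hpn => ?_, fun h4 => ?_⟩
  · by_contra hp
    have hpk : p ∣ k ^ (p - 1) - 1 :=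
      (Nat.modEq_iff_dvd' (Nat.one_le_pow _ _ hk)).1
        (by
          have := Nat.ModEq.pow_totient (hkn.coprime_dvd_right hpn)
          rw [Nat.totient_prime pp] at this
          exact this.symm)
    rw [← geom_sum_mul_of_one_le hk] at hpk
    have h1 := (pp.dvd_mul.1 hpk).resolve_right hp
    have := le_of_dvd_geom_sum hn hpn (by have := pp.two_le; omega) hinj h1
    have := pp.two_le
    omega
  · by_contra hk4
    have hodd : k % 2 = 1 := by
      have := hkn.coprime_dvd_right ((by norm_num : 2 ∣ 4).trans h4)
      exact Nat.odd_iff.1 (Nat.coprime_two_right.1 this)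
    have : 4 ∣ ∑ i ∈ Finset.range 2, k ^ i := by
      simp [Finset.sum_range_succ]
      omega
    have := le_of_dvd_geom_sum hn h4 (by norm_num) hinj this
    omega

/-! ### Cyclic groups and uniqueness of subgroups and subfields -/

theorem IsCyclic.subgroup_eq_of_card_eq {G : Type*} [Group G] [Finite G] [IsCyclic G]
    {H₁ H₂ : Subgroup G} (h : Nat.card H₁ = Nat.card H₂) : H₁ = H₂ := by
  classical
  have := Fintype.ofFinite G
  suffices key : ∀ H : Subgroup G, (H : Set G) = {a | a ^ Nat.card H = 1} from
    SetLike.coe_injective (by rw [key H₁, key H₂, h])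
  intro H
  refine Set.eq_of_subset_of_ncard_le (fun a ha => ?_) ?_ (Set.toFinite _)
  · exact congrArg Subtype.val (pow_card_eq_one' (x := (⟨a, ha⟩ : H)))
  · have := IsCyclic.card_pow_eq_one_le (α := G) (Nat.card_pos (α := H))
    rw [← Set.ncard_coe_finset, Finset.coe_filter] at this
    rw [← Nat.card_coe_set_eq (H : Set G)]
    simpa using this

/-- An element `g` whose order is the exponent generates: any `d` spans the same subgroup as the
multiple of `g` of equal order. -/
theorem isAddCyclic_of_addSubgroup_eq_of_card_eq {D : Type*} [AddCommGroup D] [Finite D]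
    (h : ∀ D₁ D₂ : AddSubgroup D, Nat.card D₁ = Nat.card D₂ → D₁ = D₂) : IsAddCyclic D := by
  have hex : AddMonoid.ExponentExists D := .of_finite
  obtain ⟨g, hg⟩ := AddMonoid.exists_addOrderOf_eq_exponent hex
  refine ⟨g, fun d => ?_⟩
  have hdvd : addOrderOf d ∣ addOrderOf g := hg ▸ AddMonoid.addOrder_dvd_exponent d
  obtain ⟨c, hc⟩ := hdvd
  have hc0 : c ≠ 0 := fun h0 => (addOrderOf_pos g).ne' (by rw [hc, h0, mul_zero])
  have := h (AddSubgroup.zmultiples d) (AddSubgroup.zmultiples (c • g)) (by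
    rw [Nat.card_zmultiples, Nat.card_zmultiples,
      addOrderOf_nsmul_of_dvd hc0 ⟨_, by rw [hc, mul_comm]⟩, hc, Nat.mul_div_cancel _ (Nat.pos_of_ne_zero hc0)])
  have hd : d ∈ AddSubgroup.zmultiples (c • g) := this ▸ AddSubgroup.mem_zmultiples d
  exact (AddSubgroup.zmultiples_le_of_mem
    (AddSubgroup.nsmul_mem _ (AddSubgroup.mem_zmultiples g) c)) hd

theorem IntermediateField.eq_of_finrank_eq_of_isCyclic {K L : Type*} [Field K] [Field L]
    [Algebra K L] [FiniteDimensional K L] [IsGalois K L] [IsCyclic (L ≃ₐ[K] L)]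
    {E₁ E₂ : IntermediateField K L} (h : Module.finrank K E₁ = Module.finrank K E₂) :
    E₁ = E₂ := by
  rw [← IsGalois.fixedField_fixingSubgroup E₁, ← IsGalois.fixedField_fixingSubgroup E₂]
  congr 1
  apply IsCyclic.subgroup_eq_of_card_eq
  rw [IsGalois.card_fixingSubgroup_eq_finrank, IsGalois.card_fixingSubgroup_eq_finrank]
  have h₁ := Module.finrank_mul_finrank K E₁ L
  rw [← Module.finrank_mul_finrank K E₂ L, h] at h₁
  exact Nat.eq_of_mul_eq_mul_left Module.finrank_pos h₁

/-! ### Structure of unitary gradings -/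

namespace IsUnitaryGrading

variable {K L D : Type*} [Field K] [Field L] [Algebra K L] [AddCommGroup D]
  {𝒜 : D → Submodule K L}

theorem mul_mem (h : IsUnitaryGrading 𝒜) {d e : D} {x y : L} (hx : x ∈ 𝒜 d) (hy : y ∈ 𝒜 e) :
    x * y ∈ 𝒜 (d + e) :=
  h.gradedMonoid.mul_mem hx hy

theorem pow_mem (h : IsUnitaryGrading 𝒜) {d : D} {x : L} (hx : x ∈ 𝒜 d) (m : ℕ) :
    x ^ m ∈ 𝒜 (m • d) :=
  haveI := h.gradedMonoid
  SetLike.pow_mem_graded m hx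

theorem mem_zero_iff (h : IsUnitaryGrading 𝒜) {x : L} :
    x ∈ 𝒜 0 ↔ ∃ a : K, algebraMap K L a = x := by
  rw [h.zero_eq]
  rfl

/-- Multiplication by a unit of degree `-d` embeds the component into `K`. -/
theorem eq_span_singleton (h : IsUnitaryGrading 𝒜) {d : D} {x : L} (hx : x ∈ 𝒜 d)
    (hx0 : x ≠ 0) : 𝒜 d = Submodule.span K {x} := by
  obtain ⟨y, hy, hyu⟩ := h.exists_unit (-d)
  have hy0 := hyu.ne_zero
  have key : ∀ z ∈ 𝒜 d, ∃ b : K, algebraMap K L b = z * y := fun z hz =>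
    h.mem_zero_iff.1 (by simpa using h.mul_mem hz hy)
  refine le_antisymm (fun z hz => ?_) (by simpa using hx)
  obtain ⟨a, ha⟩ := key x hx
  obtain ⟨b, hb⟩ := key z hz
  refine Submodule.mem_span_singleton.2 ⟨b / a, ?_⟩
  rw [Algebra.smul_def, map_div₀, ha, hb]
  field_simp

theorem exists_homogeneous (h : IsUnitaryGrading 𝒜) :
    ∃ x : D → L, (∀ d, x d ≠ 0) ∧ ∀ d, x d ∈ 𝒜 d := by
  choose x hx hxu using h.exists_unit
  exact ⟨x, fun d => (hxu d).ne_zero, hx⟩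

variable {x : D → L}

theorem linearIndependent (h : IsUnitaryGrading 𝒜) (hx0 : ∀ d, x d ≠ 0)
    (hx : ∀ d, x d ∈ 𝒜 d) : LinearIndependent K x := by
  let := Classical.decEq D
  have := h.isInternal.submodule_iSupIndep
  rw [show 𝒜 = fun d => Submodule.span K {x d} from
    funext fun d => h.eq_span_singleton (hx d) (hx0 d)] at this
  exact (iSupIndep_iff_linearIndependent_of_ne_zero hx0).1 this

theorem gradedPart_eq_span (h : IsUnitaryGrading 𝒜) (hx0 : ∀ d, x d ≠ 0)
    (hx : ∀ d, x d ∈ 𝒜 d) (D' : AddSubgroup D) :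
    gradedPart 𝒜 D' = Submodule.span K (x '' D') := by
  rw [gradedPart, Set.image_eq_iUnion, Submodule.span_iUnion₂]
  exact biSup_congr fun d _ => h.eq_span_singleton (hx d) (hx0 d)

theorem span_range_eq_top (h : IsUnitaryGrading 𝒜) (hx0 : ∀ d, x d ≠ 0)
    (hx : ∀ d, x d ∈ 𝒜 d) : Submodule.span K (Set.range x) = ⊤ := by
  let := Classical.decEq D
  rw [← h.isInternal.submodule_iSup_eq_top, Submodule.span_range_eq_iSup]
  exact iSup_congr fun d => (h.eq_span_singleton (hx d) (hx0 d)).symm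

theorem finite [FiniteDimensional K L] (h : IsUnitaryGrading 𝒜) : Finite D := by
  obtain ⟨x, hx0, hx⟩ := h.exists_homogeneous
  exact (h.linearIndependent hx0 hx).finite

theorem card_eq_finrank [FiniteDimensional K L] (h : IsUnitaryGrading 𝒜) :
    Nat.card D = Module.finrank K L := by
  obtain ⟨x, hx0, hx⟩ := h.exists_homogeneous
  exact (Module.finrank_eq_nat_card_basis (Module.Basis.mk (h.linearIndependent hx0 hx)
    (h.span_range_eq_top hx0 hx).ge)).symm

theorem finrank_gradedPart [FiniteDimensional K L] (h : IsUnitaryGrading 𝒜)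
    (D' : AddSubgroup D) : Module.finrank K (gradedPart 𝒜 D') = Nat.card D' := by
  obtain ⟨x, hx0, hx⟩ := h.exists_homogeneous
  have := h.finite
  have := Fintype.ofFinite D'
  rw [h.gradedPart_eq_span hx0 hx, Set.image_eq_range, Nat.card_eq_fintype_card]
  exact finrank_span_eq_card ((h.linearIndependent hx0 hx).comp _ Subtype.val_injective)

theorem gradedPart_injective (h : IsUnitaryGrading 𝒜) :
    Function.Injective (gradedPart 𝒜) := by
  obtain ⟨x, hx0, hx⟩ := h.exists_homogeneous
  have hmem : ∀ (D' : AddSubgroup D) (d : D), d ∈ D' ↔ x d ∈ gradedPart 𝒜 D' := fun D' d => by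
    rw [h.gradedPart_eq_span hx0 hx]
    refine ⟨fun hd => Submodule.subset_span ⟨d, hd, rfl⟩, fun hd => ?_⟩
    by_contra hd'
    exact (h.linearIndependent hx0 hx).notMem_span_image hd' hd
  intro D₁ D₂ h12
  ext d
  rw [hmem, h12, ← hmem]

theorem exists_intermediateField [FiniteDimensional K L] (h : IsUnitaryGrading 𝒜)
    (D' : AddSubgroup D) :
    ∃ E : IntermediateField K L, Subalgebra.toSubmodule E.toSubalgebra = gradedPart 𝒜 D' := by
  obtain ⟨x, hx0, hx⟩ := h.exists_homogeneous
  have hle : ∀ d ∈ D', 𝒜 d ≤ gradedPart 𝒜 D' := fun d hd => le_iSup₂_of_le d hd le_rfl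
  let S : Subalgebra K L := (gradedPart 𝒜 D').toSubalgebra
    (hle 0 D'.zero_mem h.gradedMonoid.one_mem) (by
      intro y z hy hz
      have hyz := Submodule.mul_mem_mul hy hz
      rw [h.gradedPart_eq_span hx0 hx, Submodule.span_mul_span] at hyz
      refine Submodule.span_le.2 ?_ hyz
      rintro _ ⟨_, ⟨d, hd, rfl⟩, _, ⟨e, he, rfl⟩, rfl⟩
      exact hle _ (D'.add_mem hd he) (h.mul_mem (hx d) (hx e)))
  refine ⟨S.toIntermediateField' ?_, ?_⟩
  · exact Subalgebra.isField_of_algebraic S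
  · ext
    rfl

theorem isAddCyclic [FiniteDimensional K L] [IsGalois K L] [IsCyclic (L ≃ₐ[K] L)]
    (h : IsUnitaryGrading 𝒜) : IsAddCyclic D := by
  have := h.finite
  refine isAddCyclic_of_addSubgroup_eq_of_card_eq fun D₁ D₂ h12 => h.gradedPart_injective ?_
  obtain ⟨E₁, hE₁⟩ := h.exists_intermediateField D₁
  obtain ⟨E₂, hE₂⟩ := h.exists_intermediateField D₂
  rw [← hE₁, ← hE₂, IntermediateField.eq_of_finrank_eq_of_isCyclic (E₁ := E₁) (E₂ := E₂)]
  change Module.finrank K (Subalgebra.toSubmodule E₁.toSubalgebra) =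
    Module.finrank K (Subalgebra.toSubmodule E₂.toSubalgebra)
  rw [hE₁, hE₂, h.finrank_gradedPart, h.finrank_gradedPart, h12]

/-- A homogeneous element of such degree is purely inseparable over `K`, hence lies in `K`. -/
theorem eq_zero_of_pow_nsmul_eq_zero [Algebra.IsSeparable K L] (h : IsUnitaryGrading 𝒜)
    {ℓ : ℕ} (hℓ : 0 < ℓ) [CharP K ℓ] {k : ℕ} {d : D} (hd : ℓ ^ k • d = 0) : d = 0 := by
  obtain ⟨x, hx0, hx⟩ := h.exists_homogeneous
  have : ExpChar K ℓ := .prime ((CharP.char_is_prime_or_zero K ℓ).resolve_right hℓ.ne')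
  have hmem : x d ∈ perfectClosure K L := by
    rw [mem_perfectClosure_iff_pow_mem ℓ]
    exact ⟨k, h.mem_zero_iff.1 (hd ▸ h.pow_mem (hx d) _)⟩
  rw [perfectClosure.eq_bot_of_isSeparable, IntermediateField.mem_bot] at hmem
  have h0 : x d ∈ 𝒜 0 := h.mem_zero_iff.2 hmem
  rw [h.eq_span_singleton (hx 0) (hx0 0), ← Set.image_singleton] at h0
  by_contra hd0
  exact (h.linearIndependent hx0 hx).notMem_span_image (s := {0}) hd0 h0

theorem isCoGaloisGrading [FiniteDimensional K L] [IsGalois K L] [IsCyclic (L ≃ₐ[K] L)]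
    (h : IsUnitaryGrading 𝒜) : IsCoGaloisGrading 𝒜 where
  isUnitaryGrading := h
  torsion_eq_zero _ hℓ _ _ _ hd := h.eq_zero_of_pow_nsmul_eq_zero hℓ hd
  intermediateField_graded E := by
    have := h.finite
    obtain ⟨g, hg⟩ := h.isAddCyclic
    have hgc : addOrderOf g = Module.finrank K L := by
      rw [addOrderOf_eq_card_of_forall_mem_zmultiples hg, h.card_eq_finrank]
    rw [← Module.finrank_mul_finrank K E L] at hgc
    have hpos : 0 < Module.finrank E L := Module.finrank_pos
    let D' := AddSubgroup.zmultiples (Module.finrank E L • g)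
    have hD' : Nat.card D' = Module.finrank K E := by
      rw [Nat.card_zmultiples,
        addOrderOf_nsmul_of_dvd hpos.ne' (by rw [hgc]; exact dvd_mul_left _ _), hgc,
        Nat.mul_div_cancel _ hpos]
    obtain ⟨E', hE'⟩ := h.exists_intermediateField D'
    refine ⟨D', ?_⟩
    rw [← hE', IntermediateField.eq_of_finrank_eq_of_isCyclic (E₁ := E) (E₂ := E')]
    change _ = Module.finrank K (Subalgebra.toSubmodule E'.toSubalgebra)
    rw [hE', h.finrank_gradedPart, hD']

end IsUnitaryGrading

/-! ### Radical generators of cyclic extensions -/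

section

variable {K L : Type*} [Field K] [Field L] [Algebra K L]

theorem pow_algEquiv_apply_eq_geom_sum {σ : L ≃ₐ[K] L} {ζ x : L} {k : ℕ} (hζ : σ ζ = ζ ^ k)
    (hx : σ x = ζ * x) (j : ℕ) : (σ ^ j) x = ζ ^ (∑ i ∈ Finset.range j, k ^ i) * x := by
  induction j with
  | zero => simp
  | succ j ih =>
    rw [pow_succ', AlgEquiv.mul_apply, ih, map_mul, map_pow, hζ, hx, ← mul_assoc, ← pow_mul,
      ← pow_succ, geom_sum_succ]

theorem exists_algEquiv_apply_eq_pow (σ : L ≃ₐ[K] L) {ζ : L} {n : ℕ} (hn : n ≠ 0)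
    (hζ : ζ ^ n = 1) : ∃ k, 1 ≤ k ∧ σ ζ = ζ ^ k := by
  have : NeZero n := ⟨hn⟩
  obtain ⟨k, hk⟩ := map_rootsOfUnity_eq_pow_self σ (rootsOfUnity.mkOfPowEq ζ hζ)
  -- Adding `n` ensures a positive exponent, so that `k - 1` is not truncated.
  refine ⟨k + n, by omega, ?_⟩
  rw [pow_add, hζ, mul_one]
  simpa using hk

theorem mem_range_algebraMap_of_generator_apply_eq [FiniteDimensional K L] [IsGalois K L]
    {σ : L ≃ₐ[K] L} (hσ : ∀ τ, τ ∈ Subgroup.zpowers σ) {x : L} (hx : σ x = x) :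
    ∃ a : K, algebraMap K L a = x := by
  rw [← Set.mem_range, ← IntermediateField.mem_bot, IsGalois.mem_bot_iff_fixed]
  have : Subgroup.zpowers σ ≤ MulAction.stabilizer (L ≃ₐ[K] L) x := by
    rwa [Subgroup.zpowers_le]
  exact fun τ => this (hσ τ)

theorem orderOf_generator_eq_finrank [FiniteDimensional K L] [IsGalois K L]
    {σ : L ≃ₐ[K] L} (hσ : ∀ τ, τ ∈ Subgroup.zpowers σ) : orderOf σ = Module.finrank K L := by
  rw [orderOf_eq_card_of_forall_mem_zpowers hσ, IsGalois.card_aut_eq_finrank]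

theorem IsUnitaryGrading.exists_adjoin_eq_top [FiniteDimensional K L] [IsGalois K L]
    [IsCyclic (L ≃ₐ[K] L)] {D : Type*} [AddCommGroup D] {𝒜 : D → Submodule K L}
    (h : IsUnitaryGrading 𝒜) :
    ∃ x : L, x ≠ 0 ∧ Algebra.adjoin K {x} = ⊤ ∧
      ∃ a : K, algebraMap K L a = x ^ Module.finrank K L := by
  obtain ⟨g, hg⟩ := h.isAddCyclic
  obtain ⟨y, hy0, hy⟩ := h.exists_homogeneous
  have := h.finite
  refine ⟨y g, hy0 g, ?_, ?_⟩
  · rw [← Algebra.toSubmodule_eq_top, eq_top_iff, ← h.span_range_eq_top hy0 hy, Submodule.span_le]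
    rintro _ ⟨d, rfl⟩
    obtain ⟨i, rfl⟩ := mem_multiples_iff_mem_zmultiples.2
      (AddSubgroup.mem_zmultiples_iff.2 (hg d))
    have := hy (i • g)
    rw [h.eq_span_singleton (h.pow_mem (hy g) i) (pow_ne_zero _ (hy0 g))] at this
    refine (Submodule.span_le.2 ?_) this
    rw [Set.singleton_subset_iff]
    exact _root_.pow_mem (Algebra.self_mem_adjoin_singleton K (y g)) i
  · refine h.mem_zero_iff.1 ?_
    have := h.pow_mem (hy g) (Nat.card D)
    rwa [card_nsmul_eq_zero', h.card_eq_finrank] at this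

theorem exists_isPrimitiveRoot_of_adjoin_eq_top [FiniteDimensional K L] [IsGalois K L]
    [IsCyclic (L ≃ₐ[K] L)] {n : ℕ} (hn : Module.finrank K L = n) {x : L} (hx0 : x ≠ 0)
    (hx : Algebra.adjoin K {x} = ⊤) {a : K} (ha : algebraMap K L a = x ^ n) :
    (∃ ζ : L, IsPrimitiveRoot ζ n) ∧ ∃ ξ : K, IsPrimitiveRoot ξ (ered n) := by
  have hn0 : n ≠ 0 := hn ▸ Module.finrank_pos.ne'
  have hnpos := Nat.pos_of_ne_zero hn0
  obtain ⟨σ, hσ⟩ := IsCyclic.exists_generator (α := L ≃ₐ[K] L)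
  have hord : orderOf σ = n := hn ▸ orderOf_generator_eq_finrank hσ
  set ζ := σ x / x with hζdef
  have hσx : σ x = ζ * x := (div_mul_cancel₀ _ hx0).symm
  have hζn : ζ ^ n = 1 := by
    rw [hζdef, div_pow, ← map_pow, ← ha, AlgEquiv.commutes, ha, div_self (pow_ne_zero _ hx0)]
  obtain ⟨k, hk1, hk⟩ := exists_algEquiv_apply_eq_pow σ hn0 hζn
  have hinj : Set.InjOn (fun j => (∑ i ∈ Finset.range j, k ^ i) % orderOf ζ)
      (Finset.range n) := by
    intro i hi j hj hij
    have h1 : (σ ^ i) x = (σ ^ j) x := by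
      rw [pow_algEquiv_apply_eq_geom_sum hk hσx, pow_algEquiv_apply_eq_geom_sum hk hσx,
        ← pow_mod_orderOf, ← pow_mod_orderOf ζ (∑ i ∈ Finset.range j, k ^ i)]
      exact congrArg (fun m => ζ ^ m * x) hij
    have h2 : (σ ^ i : L ≃ₐ[K] L).toAlgHom = (σ ^ j : L ≃ₐ[K] L).toAlgHom :=
      AlgHom.ext_of_adjoin_eq_top hx (by simpa using h1)
    have h3 : σ ^ i = σ ^ j := AlgEquiv.ext fun z => DFunLike.congr_fun h2 z
    rw [Finset.coe_range, ← hord] at hi hj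
    exact pow_injOn_Iio_orderOf hi hj h3
  have hζpos : 0 < orderOf ζ := orderOf_pos_iff.2 (isOfFinOrder_iff_pow_eq_one.2 ⟨n, hnpos, hζn⟩)
  have hζord : orderOf ζ = n := by
    -- Pigeonhole: `n` distinct residues modulo the order of `ζ`.
    refine le_antisymm (orderOf_le_of_pow_eq_one hnpos hζn) ?_
    simpa using Finset.card_le_card_of_injOn (t := Finset.range (orderOf ζ)) _
      (fun j _ => by simpa using Nat.mod_lt _ hζpos) hinj
  have hprim : IsPrimitiveRoot ζ n := hζord ▸ IsPrimitiveRoot.orderOf ζ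
  refine ⟨⟨ζ, hprim⟩, ?_⟩
  rw [hζord] at hinj
  have hcop : k.Coprime n := (hprim.pow_iff_coprime hnpos k).1
    (hk ▸ hprim.map_of_injective σ.injective)
  obtain ⟨c, hc⟩ := ered_dvd_of_injOn_geom_sum hn0 hk1 hcop hinj
  obtain ⟨m, hm⟩ := ered_dvd_self hn0
  have hfix : σ (ζ ^ m) = ζ ^ m := by
    rw [map_pow, hk, ← pow_mul, ← Nat.sub_add_cancel hk1, hc, add_mul, one_mul, pow_add,
      mul_right_comm, ← hm, pow_mul, hζn, one_pow, one_mul]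
  obtain ⟨ξ, hξ⟩ := mem_range_algebraMap_of_generator_apply_eq hσ hfix
  refine ⟨ξ, IsPrimitiveRoot.of_map_of_injective (f := algebraMap K L) ?_
    (algebraMap K L).injective⟩
  rw [hξ]
  exact hprim.pow hnpos (by rw [mul_comm]; exact hm)

/-- A Lagrange resolvent: a multiplicative form of Hilbert 90 for a root of unity. -/
theorem exists_algEquiv_apply_eq_mul {σ : L ≃ₐ[K] L} {n : ℕ} (hord : orderOf σ = n)
    (hn : n ≠ 0) {ζ : L} (hζ0 : ζ ≠ 0) {k : ℕ} (hk : σ ζ = ζ ^ k)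
    (hS : ζ ^ (∑ i ∈ Finset.range n, k ^ i) = 1) : ∃ x : L, x ≠ 0 ∧ σ x = ζ * x := by
  -- Chosen so that `σ` shifts the terms of the resolvent up to the factor `ζ`; `hS` closes the
  -- cycle.
  let c : ℕ → L := fun j => (ζ ^ (∑ i ∈ Finset.range j, k ^ i))⁻¹
  have hc : ∀ j, σ (c j) = ζ * c (j + 1) := fun j => by
    simp only [c]
    rw [map_inv₀, map_pow, hk, geom_sum_succ, pow_succ, pow_mul]
    field_simp
  have hli : LinearIndependent L fun j : Fin n => ((σ ^ (j : ℕ) : L ≃ₐ[K] L) : L → L) :=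
    (linearIndependent_monoidHom L L).comp
      (fun j : Fin n => ((σ ^ (j : ℕ) : L ≃ₐ[K] L) : L →* L)) fun i j hij => Fin.ext <| by
        refine pow_injOn_Iio_orderOf (x := σ) (by simp [hord]) (by simp [hord]) ?_
        exact AlgEquiv.ext fun z => DFunLike.congr_fun hij z
  -- Dedekind independence makes some resolvent nonzero.
  obtain ⟨z, hz⟩ : ∃ z, ∑ j ∈ Finset.range n, c j * (σ ^ j) z ≠ 0 := by
    by_contra! hz
    have h0 := Fintype.linearIndependent_iff.1 hli (fun j => c j) (by
      ext z
      simpa [Finset.sum_range] using hz z) ⟨0, Nat.pos_of_ne_zero hn⟩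
    simp [c] at h0
  refine ⟨_, hz, ?_⟩
  have hshift : ∑ j ∈ Finset.range n, c (j + 1) * (σ ^ (j + 1)) z =
      ∑ j ∈ Finset.range n, c j * (σ ^ j) z := by
    have h1 := Finset.sum_range_succ (fun j => c j * (σ ^ j) z) n
    rw [Finset.sum_range_succ'] at h1
    have h2 : c n * (σ ^ n) z = c 0 * (σ ^ 0) z := by
      have : σ ^ n = 1 := hord ▸ pow_orderOf_eq_one σ
      simp [c, hS, this]
    rw [h2] at h1
    exact add_right_cancel h1
  rw [map_sum]
  conv_rhs => rw [← hshift, Finset.mul_sum]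
  refine Finset.sum_congr rfl fun j _ => ?_
  rw [map_mul, hc, pow_succ', AlgEquiv.mul_apply, mul_assoc]

theorem isUnitaryGrading_span_singleton {D : Type*} [AddCommGroup D] {y : D → L}
    (hli : LinearIndependent K y) (hspan : Submodule.span K (Set.range y) = ⊤)
    (h0 : y 0 = 1) (hmul : ∀ d e, ∃ a : K, y d * y e = a • y (d + e)) :
    IsUnitaryGrading fun d => Submodule.span K {y d} where
  gradedMonoid :=
    { one_mem := by rw [h0]; exact Submodule.mem_span_singleton_self 1
      mul_mem := by
        intro d e u v hu hv
        obtain ⟨a, rfl⟩ := Submodule.mem_span_singleton.1 hu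
        obtain ⟨b, rfl⟩ := Submodule.mem_span_singleton.1 hv
        obtain ⟨c, hc⟩ := hmul d e
        rw [smul_mul_smul_comm, hc, smul_smul]
        exact Submodule.smul_mem _ _ (Submodule.mem_span_singleton_self _) }
  isInternal := by
    let := Classical.decEq D
    refine DirectSum.isInternal_submodule_of_iSupIndep_of_iSup_eq_top
      hli.iSupIndep_span_singleton ?_
    rw [← Submodule.span_range_eq_iSup, hspan]
  algebraMap_injective := (algebraMap K L).injective
  zero_eq := by
    ext z
    simp [h0, Submodule.mem_span_singleton, Algebra.algebraMap_eq_smul_one]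
  exists_unit d := ⟨y d, Submodule.mem_span_singleton_self _, (hli.ne_zero d).isUnit⟩

theorem exists_adjoin_eq_top_and_pow_mem_range [FiniteDimensional K L] [IsGalois K L]
    [IsCyclic (L ≃ₐ[K] L)] {n : ℕ} (hn : Module.finrank K L = n) {ζ : L}
    (hζ : IsPrimitiveRoot ζ n) {ξ : K} (hξ : IsPrimitiveRoot ξ (ered n)) :
    ∃ x : L, IntermediateField.adjoin K {x} = ⊤ ∧ ∃ a : K, algebraMap K L a = x ^ n := by
  have hn0 : n ≠ 0 := hn ▸ Module.finrank_pos.ne'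
  have hnpos := Nat.pos_of_ne_zero hn0
  obtain ⟨σ, hσ⟩ := IsCyclic.exists_generator (α := L ≃ₐ[K] L)
  have hord : orderOf σ = n := hn ▸ orderOf_generator_eq_finrank hσ
  obtain ⟨k, hk1, hk⟩ := exists_algEquiv_apply_eq_pow σ hn0 hζ.pow_eq_one
  have hζ0 : ζ ≠ 0 := hζ.ne_zero hn0
  obtain ⟨m, hm⟩ := ered_dvd_self hn0
  have hem : 0 < ered n ∧ 0 < m := by
    constructor <;> refine Nat.pos_of_ne_zero fun h => hn0 (hm.trans (by simp [h]))
  have : NeZero (ered n) := ⟨hem.1.ne'⟩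
  obtain ⟨i, -, hi⟩ := (hξ.map_of_injective (algebraMap K L).injective).eq_pow_of_pow_eq_one
    (ξ := ζ ^ m) (by rw [← pow_mul, mul_comm, ← hm, hζ.pow_eq_one])
  have hfix : σ (ζ ^ m) = ζ ^ m := by
    rw [← hi, ← map_pow, AlgEquiv.commutes]
  have hered : ered n ∣ k - 1 := by
    rw [map_pow, hk, ← pow_mul, ← Nat.sub_add_cancel hk1, add_mul, one_mul, pow_add] at hfix
    have h1 := (hζ.pow_eq_one_iff_dvd _).1
      (mul_right_cancel₀ (pow_ne_zero m hζ0) (hfix.trans (one_mul _).symm))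
    rw [hm] at h1
    exact Nat.dvd_of_mul_dvd_mul_right hem.2 h1
  have hS := dvd_geom_sum_iff_of_ered_dvd hn0 hk1 hered
  obtain ⟨x, hx0, hx⟩ := exists_algEquiv_apply_eq_mul hord hn0 hζ0 hk
    ((hζ.pow_eq_one_iff_dvd _).2 ((hS n).2 dvd_rfl))
  refine ⟨x, ?_, mem_range_algebraMap_of_generator_apply_eq hσ ?_⟩
  · rw [← IsGalois.fixedField_fixingSubgroup (IntermediateField.adjoin K {x}),
      (_ : IntermediateField.fixingSubgroup _ = ⊥), IntermediateField.fixedField_bot]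
    rw [eq_bot_iff]
    intro τ hτ
    obtain ⟨j, rfl⟩ := mem_powers_iff_mem_zpowers.2 (hσ τ)
    have h1 := (IntermediateField.mem_fixingSubgroup_iff _ _).1 hτ x
      (IntermediateField.mem_adjoin_simple_self K x)
    change (σ ^ j) x = x at h1
    rw [pow_algEquiv_apply_eq_geom_sum hk hx] at h1
    have h2 := (hζ.pow_eq_one_iff_dvd _).1
      (mul_right_cancel₀ hx0 (h1.trans (one_mul _).symm))
    exact orderOf_dvd_iff_pow_eq_one.1 (hord ▸ (hS j).1 h2)
  · rw [map_pow, hx, mul_pow, hζ.pow_eq_one, one_mul]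

universe u

theorem exists_isUnitaryGrading_of_adjoin_eq_top [FiniteDimensional K L] {n : ℕ}
    (hn : Module.finrank K L = n) {x : L} (hx : IntermediateField.adjoin K {x} = ⊤) {a : K}
    (ha : algebraMap K L a = x ^ n) :
    ∃ (D : Type u) (_ : AddCommGroup D) (𝒜 : D → Submodule K L), IsUnitaryGrading 𝒜 := by
  have : NeZero n := ⟨hn ▸ Module.finrank_pos.ne'⟩
  have hdeg : (minpoly K x).natDegree = n :=
    hn ▸ (Field.primitive_element_iff_minpoly_natDegree_eq K x).1 hx
  -- Powers of `x` with exponents below `n`; wrapping around costs a factor `a`.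
  let y : ULift.{u} (ZMod n) → L := fun d => x ^ d.down.val
  have hli : LinearIndependent K y :=
    (linearIndependent_pow (K := K) x).comp
      (fun d : ULift.{u} (ZMod n) => ⟨d.down.val, (ZMod.val_lt _).trans_eq hdeg.symm⟩) fun d e hde =>
        ULift.down_injective (ZMod.val_injective n (congrArg Fin.val hde))
  refine ⟨ULift.{u} (ZMod n), inferInstance, _, isUnitaryGrading_span_singleton hli
    (hli.span_eq_top_of_card_eq_finrank' (by simp [hn, ZMod.card])) (by simp [y])
    fun d e => ⟨a ^ ((d.down.val + e.down.val) / n), ?_⟩⟩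
  simp only [y, ULift.add_down, ZMod.val_add]
  rw [Algebra.smul_def, map_pow, ha, ← pow_add, ← pow_mul, ← pow_add, Nat.div_add_mod]

end

theorem mainTheorem6 {K L : Type*} [Field K] [Field L] [Algebra K L]
    [FiniteDimensional K L] [IsGalois K L] [IsCyclic (L ≃ₐ[K] L)]
    (n : ℕ) (hn : Module.finrank K L = n) :
    ((∃ (D : Type*) (_ : AddCommGroup D) (𝒜 : D → Submodule K L), IsUnitaryGrading 𝒜) ↔
      (Nat.card (rootsOfUnity n L) = n ∧ Nat.card (rootsOfUnity (ered n) K) = ered n)) ∧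
    (∀ (D : Type*) [AddCommGroup D] (𝒜 : D → Submodule K L),
      IsUnitaryGrading 𝒜 → IsCoGaloisGrading 𝒜) := by
  refine ⟨?_, fun D _ 𝒜 h => h.isCoGaloisGrading⟩
  have hn0 : n ≠ 0 := hn ▸ Module.finrank_pos.ne'
  have : NeZero n := ⟨hn0⟩
  have : NeZero (ered n) := ⟨ne_zero_of_dvd_ne_zero hn0 (ered_dvd_self hn0)⟩
  rw [card_rootsOfUnity_eq_iff_exists_isPrimitiveRoot,
    card_rootsOfUnity_eq_iff_exists_isPrimitiveRoot]
  constructor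
  · rintro ⟨D, _, 𝒜, h⟩
    obtain ⟨x, hx0, hx, a, ha⟩ := h.exists_adjoin_eq_top
    exact exists_isPrimitiveRoot_of_adjoin_eq_top hn hx0 hx (hn ▸ ha)
  · rintro ⟨⟨ζ, hζ⟩, ξ, hξ⟩
    obtain ⟨x, hx, a, ha⟩ := exists_adjoin_eq_top_and_pow_mem_range hn hζ hξ
    exact exists_isUnitaryGrading_of_adjoin_eq_top hn hx ha
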